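/- Let $N\ge 0$ and $d\ge 1$, and consider $N$ qudits with Hilbert space $(\mathbb C^d)^{\otimes N}$. Definitions. A measurement pair on a finite-dimensional Hilbert space is $\mathbf M=\{M_{a|x}\}$ with settings $x\in\{1,2\}$ and finitely many outcomes $a$, such that $M_{a|x}\ge 0$ and $\sum_a M_{a|x}=I$ for each $x$. It is compatible if there are a POVM $\{G_\lambda\}$ with finitely many outcomes and conditional probability distributions $p(a|x,\lambda)$ with $M_{a|x}=\sum_\lambda p(a|x,\lambda)G_\lambda$ for all $a,x$. Its generalized incompatibility robustness $\mathcal R_g(\mathbf M)$ is the infimum of the $s\ge 0$ for which there is a measurement pair $\mathbf K$, with the same outcomes and on the same space, such that $(\mathbf M+s\mathbf K)/(1+s)$ is compatible. For a measurement pair $\mathbf M$ on the $N$ qudits and a set $\alpha$ of qudits, the reduction $\mathbf M_\alpha$ has the effects $d^{-(N-|\alpha|)}\,\mathrm{Tr}_{\bar\alpha}(M_{a|x})$, where $\bar\alpha$ is the complement of $\alpha$; this is a measurement pair on the qudits in $\alpha$. For a hypergraph $\mathcal H$ whose vertices are qudits (any set of qudits may be a hyperedge), the allocation of $\mathbf M$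 is the list $\mathcal A_{\mathcal H}[\mathbf M]=(\mathcal R_g(\mathbf M_\alpha))_{\alpha\in\mathcal E_{\mathcal H}}$. Two orthonormal bases of a $D$-dimensional space are unbiased if $|\langle u_a|v_b\rangle|^2=1/D$ for all $a,b$. A pair of product unbiased bases consists of the bases $|u^x_{\mathbf a}\rangle=|u^x_{a_1}\rangle\otimes\dots\otimes|u^x_{a_N}\rangle$, $x\in\{1,2\}$, where for each qudit $k$ the vectors $|u^1_{a_k}\rangle$ and $|u^2_{a_k}\rangle$ form two unbiased orthonormal bases of $\mathbb C^d$ (which may depend on $k$). Let $\widetilde{\mathbf M}$ be given by the projectors $|u^x_{\mathbf a}\rangle\langle u^x_{\mathbf a}|$. Theorem. Pairs of product unbiased bases exist for all $N$ and $d$, and for each of them the following holds. (1) The two product bases are unbiased orthonormal bases of $(\mathbb C^d)^{\otimes N}$ and $\widetilde{\mathbf M}$ is a measurement pair. (2) For every set $\alpha$ of qudits, the tensor products over the qudits in $\alpha$ form again a pair of unbiased orthonormal bases $|u^x_{\mathbf a_\alpha}\rangle$; the effects of $\widetilde{\mathbf M}_\alpha$ are $d^{-(N-|\alpha|)}|u^x_{\mathbf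 a_\alpha}\rangle\langle u^x_{\mathbf a_\alpha}|$, where $\mathbf a_\alpha$ is the restriction of $\mathbf a$ to $\alpha$; $\mathcal R_g(\widetilde{\mathbf M}_\alpha)$ equals the robustness of the pair of projective measurements onto these product unbiased bases, the infimum that defines $\mathcal R_g(\widetilde{\mathbf M}_\alpha)$ is attained, and for every measurement pair $\mathbf P$ on the qudits in $\alpha$ (any finite number of outcomes) the set that defines $\mathcal R_g(\mathbf P)$ is non-empty and $\mathcal R_g(\mathbf P)\le\mathcal R_g(\widetilde{\mathbf M}_\alpha)$. (3) For every hypergraph $\mathcal H$ and every performance function $\Phi$ of the allocation, with values in $[-\infty,\infty]$, which is non-decreasing in each entry, $\Phi(\mathcal A_{\mathcal H}[\mathbf M])\le\Phi(\mathcal A_{\mathcal H}[\widetilde{\mathbf M}])$ for all measurement pairs $\mathbf M$ on the $N$ qudits, with any finite number of outcomes. In particular this holds for $\Phi=\sum_\alpha\Phi_\alpha(\mathcal R_g(\mathbf M_\alpha))$ with non-decreasing $\Phi_\alpha$, for the proportional fairness $\sum_\alpha\log\mathcal R_g(\mathbf M_\alpha)$ (with $\log 0=-\infty$), and for the reliability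 $\sum_\alpha\pi_\alpha\mathcal R_g(\mathbf M_\alpha)$, where $\pi_\alpha=\prod_{i\in\alpha}p_i\prod_{j\notin\alpha}(1-p_j)$ with $p_i\in[0,1]$. -/

import Mathlib

open scoped BigOperators NNReal ENNReal ComplexOrder Classical

noncomputable section

/-- A family of measurements (POVMs) on the Hilbert space `ℂⁿ`, indexed by the settings `X`, all
with outcomes in `O`: the effects `M x a` are positive semidefinite and sum to the identity for
every setting `x`. -/
def IsMeasurementSet {X O n : Type*} [Fintype O] [DecidableEq n]
    (M : X → O → Matrix n n ℂ) : Prop :=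
  (∀ x a, (M x a).PosSemidef) ∧ ∀ x, ∑ a, M x a = 1

/-- Joint measurability (compatibility): there are a parent POVM `G` with finitely many outcomes
and conditional probability distributions `p x l` on the outcomes `O`, such that
`M x a = ∑ l, p x l a • G l`. -/
def IsCompatible {X O n : Type*} [Fintype O] [DecidableEq n]
    (M : X → O → Matrix n n ℂ) : Prop :=
  ∃ (m : ℕ) (G : Fin m → Matrix n n ℂ) (p : X → Fin m → O → ℝ),
    (∀ l, (G l).PosSemidef) ∧ ∑ l, G l = 1 ∧
    (∀ x l a, 0 ≤ p x l a) ∧ (∀ x l, ∑ a, p x l a = 1) ∧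
    ∀ x a, M x a = ∑ l, p x l a • G l

/-- The noise levels `s ≥ 0` for which some measurement set `K` (same settings, outcomes and
Hilbert space) makes the mixture `(M + s K) / (1 + s)` compatible. -/
def robustnessSet {X O n : Type*} [Fintype O] [DecidableEq n]
    (M : X → O → Matrix n n ℂ) : Set ℝ≥0 :=
  {s | ∃ K : X → O → Matrix n n ℂ, IsMeasurementSet K ∧
    IsCompatible fun x a => (1 + (s : ℝ))⁻¹ • (M x a + (s : ℝ) • K x a)}

/-- The generalized incompatibility robustness. -/
def genRobustness {X O n : Type*} [Fintype O] [DecidableEq n]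
    (M : X → O → Matrix n n ℂ) : ℝ≥0 :=
  sInf (robustnessSet M)

/-- The computational basis label of all `N` qudits obtained from labels for the qudits in `α` and
for the remaining ones. -/
def mergeLabels {N d : ℕ} (α : Set (Fin N)) (f : α → Fin d) (h : ↥αᶜ → Fin d) : Fin N → Fin d :=
  fun i => if hi : i ∈ α then f ⟨i, hi⟩ else h ⟨i, hi⟩

/-- The partial trace of an operator on `(ℂᵈ)^{⊗ N}` over the qudits outside `α`. -/
def partialTrace {N d : ℕ} (α : Set (Fin N)) (A : Matrix (Fin N → Fin d) (Fin N → Fin d) ℂ) :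
    Matrix (α → Fin d) (α → Fin d) ℂ :=
  ∑ h : ↥αᶜ → Fin d, A.submatrix (fun f => mergeLabels α f h) (fun f => mergeLabels α f h)

/-- The reduction of a measurement set on `N` qudits to the qudits in `α`: each effect is replaced
by its partial trace over the complement of `α`, divided by the dimension of the traced out
systems (so that the effects sum to the identity again). -/
def reducedMeasurement {N d : ℕ} {X O : Type*} (α : Set (Fin N))
    (M : X → O → Matrix (Fin N → Fin d) (Fin N → Fin d) ℂ) :
    X → O → Matrix (α → Fin d) (α → Fin d) ℂ :=
  fun x a => ((d : ℂ) ^ Fintype.card ↥αᶜ)⁻¹ • partialTrace α (M x a)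

/-- Two mutually unbiased orthonormal bases of `ℂⁿ` (vectors labelled by `n`):
`|⟨u x a, u y b⟩|²` is `δ_{ab}` for `x = y` and `1 / dim` for `x ≠ y`. -/
def IsUnbiasedPair {n : Type*} [Fintype n] (u : Fin 2 → n → EuclideanSpace ℂ n) : Prop :=
  ∀ x y a b, ‖inner ℂ (u x a) (u y b)‖ ^ 2 =
    if x = y then (if a = b then (1 : ℝ) else 0) else 1 / (Fintype.card n : ℝ)

/-- The product vectors `⨂ₖ v k (a k)` of `(ℂᵈ)^{⊗ S}`, where `v k` lists vectors of the `k`-th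
tensor factor. -/
def productVector {S : Type*} [Fintype S] {d : ℕ}
    (v : S → Fin d → EuclideanSpace ℂ (Fin d)) (a : S → Fin d) : EuclideanSpace ℂ (S → Fin d) :=
  WithLp.toLp 2 fun i => ∏ k, v k (a k) (i k)

/-- The effects `|u x a⟩⟨u x a|`. -/
def rankOneMeasurement {X O n : Type*} (u : X → O → EuclideanSpace ℂ n) :
    X → O → Matrix n n ℂ :=
  fun x a => Matrix.vecMulVec (fun i => u x a i) (fun i => star (u x a i))

/-- The allocation over the hypergraph `H`: the list of the generalized robustnesses of the
reductions to the hyperedges. -/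
def allocation {N d : ℕ} {X O : Type*} [Fintype O] (H : Hypergraph (Fin N))
    (M : X → O → Matrix (Fin N → Fin d) (Fin N → Fin d) ℂ) : H.edgeSet → ℝ≥0 :=
  fun α => genRobustness (reducedMeasurement (α : Set (Fin N)) M)

/-- The performance given by a sum over hyperedges. Extended real values allow `log 0 = -∞`. -/
def performance {N : ℕ} (H : Hypergraph (Fin N)) (φ : H.edgeSet → ℝ≥0 → EReal)
    (A : H.edgeSet → ℝ≥0) : EReal :=
  ∑ α, φ α (A α)

/-- The performance of proportional fairness, `∑ log`. -/
def fairness {N : ℕ} (H : Hypergraph (Fin N)) : (H.edgeSet → ℝ≥0) → EReal :=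
  performance H fun _ r => ENNReal.log (r : ℝ≥0∞)

/-- The probability that exactly the parties in `α` work, when party `i` works with
probability `p i`, independently. -/
def workProb {N : ℕ} (p : Fin N → ℝ) (α : Set (Fin N)) : ℝ :=
  (∏ i : α, p i) * ∏ i : ↥αᶜ, (1 - p i)

/-- The performance of reliability. -/
def reliability {N : ℕ} (H : Hypergraph (Fin N)) (p : Fin N → ℝ) : (H.edgeSet → ℝ≥0) → EReal :=
  performance H fun α r => ((workProb p α * (r : ℝ) : ℝ) : EReal)

/-- The pair of measurements `M` is a feasible optimal solution for the performance `Φ` of the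
allocation over `H`: it is a pair of POVMs, and no pair of POVMs on the `N` qudits, with any finite
number of outcomes, performs better. -/
def IsOptimalSolution {N d : ℕ} {O : Type*} [Fintype O] (H : Hypergraph (Fin N))
    (Φ : (H.edgeSet → ℝ≥0) → EReal)
    (M : Fin 2 → O → Matrix (Fin N → Fin d) (Fin N → Fin d) ℂ) : Prop :=
  IsMeasurementSet M ∧
    ∀ (o : ℕ) (P : Fin 2 → Fin o → Matrix (Fin N → Fin d) (Fin N → Fin d) ℂ),
      IsMeasurementSet P → Φ (allocation H P) ≤ Φ (allocation H M)

end

/-! One number governs everything: on a space of dimension `D`, every pair of measurements becomes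
compatible at `1 + s = 2√D / (1 + √D)`, and unbiased bases need exactly that much noise.

Upper bound (`unbiasedRobustness_mem_robustnessSet`): split all effects into rank one pieces `V =
|v⟩⟨v|` and `W = |w⟩⟨w|`, and use the parent effects `(VW + WV + pV + qW) / (2(1 + √D))`. They are
positive if `|⟨v,w⟩|² ≤ pq`. The weight `p` is `√D` times the average of two probability
distributions in `w`, namely `|⟨v,w⟩|²/‖v‖²` and `‖w‖²/D`; symmetrically for `q`. AM-GM gives `pq ≥
|⟨v,w⟩|²`, and the marginals, multiplied by `1 + s`, dominate the original effects by a weighted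
Cauchy-Schwarz inequality. The excess supplies the noise measurement.

Lower bound (`IsUnbiasedPair.unbiasedRobustness_le`): projectors onto vectors from two unbiased
bases satisfy `P + Q ≤ 1 + 1/√D`. Used as a witness, this forces `2D ≤ (1 + s)(1 + 1/√D)D`.

Reducing product unbiased bases gives product unbiased bases again, up to repeated and rescaled
effects. So all reductions attain the universal bound simultaneously, with `D = d^|α|`, and the
allocation is maximal entry by entry. Monotonicity of the performance is then all that is needed. -/

noncomputable section

/-- The rank one operator `|v⟩⟨v|`. -/
def rankOne {n : Type*} (v : n → ℂ) : Matrix n n ℂ :=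
  Matrix.vecMulVec v (star v)

/-! ### Rank one operators and the joint effect of two of them -/

section RankOne

open Matrix

variable {n : Type*}

theorem rankOne_posSemidef [Finite n] (v : n → ℂ) : (rankOne v).PosSemidef :=
  posSemidef_vecMulVec_self_star v

variable [Fintype n]

theorem dotProduct_rankOne_mulVec (v w : n → ℂ) :
    star w ⬝ᵥ (rankOne v *ᵥ w) = ((‖star v ⬝ᵥ w‖ ^ 2 : ℝ) : ℂ) := by
  rw [rankOne, vecMulVec_mulVec, dotProduct_smul, ← Complex.normSq_eq_norm_sq,
    ← Complex.mul_conj, op_smul_eq_mul, starRingEnd_apply,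
    ← star_dotProduct, mul_comm]

theorem norm_star_dotProduct_comm (v w : n → ℂ) : ‖star v ⬝ᵥ w‖ = ‖star w ⬝ᵥ v‖ := by
  rw [← norm_star, ← star_dotProduct]

theorem rankOne_mul_rankOne (v w : n → ℂ) :
    rankOne v * rankOne w = (star v ⬝ᵥ w) • vecMulVec v (star w) := by
  rw [rankOne, rankOne, vecMulVec_mul_vecMulVec, vecMulVec_smul]

theorem dotProduct_rankOne_mul_rankOne_mulVec (v w z : n → ℂ) :
    star z ⬝ᵥ ((rankOne v * rankOne w) *ᵥ z) =
      (star v ⬝ᵥ w) * (star z ⬝ᵥ v) * (star w ⬝ᵥ z) := by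
  rw [rankOne_mul_rankOne, smul_mulVec, vecMulVec_mulVec, dotProduct_smul, dotProduct_smul,
    op_smul_eq_mul, smul_eq_mul]
  ring

/-- The squared norm of a vector. -/
def vecNormSq (v : n → ℂ) : ℝ := ∑ i, ‖v i‖ ^ 2

theorem vecNormSq_nonneg (v : n → ℂ) : 0 ≤ vecNormSq v :=
  Finset.sum_nonneg fun _ _ => by positivity

theorem star_dotProduct_self_eq (v : n → ℂ) : star v ⬝ᵥ v = (vecNormSq v : ℂ) := by
  simp [dotProduct, vecNormSq, ← Complex.normSq_eq_norm_sq, Complex.normSq_eq_conj_mul_self]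

theorem trace_rankOne (v : n → ℂ) : (rankOne v).trace = (vecNormSq v : ℂ) := by
  rw [rankOne, trace_vecMulVec, dotProduct_comm, star_dotProduct_self_eq]

theorem norm_star_dotProduct_sq_le (v w : n → ℂ) :
    ‖star v ⬝ᵥ w‖ ^ 2 ≤ vecNormSq v * vecNormSq w := by
  have h : ‖star v ⬝ᵥ w‖ ≤ ∑ i, ‖v i‖ * ‖w i‖ :=
    (norm_sum_le _ _).trans (le_of_eq (by simp))
  calc ‖star v ⬝ᵥ w‖ ^ 2 ≤ (∑ i, ‖v i‖ * ‖w i‖) ^ 2 := by gcongr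
    _ ≤ _ := Finset.sum_mul_sq_le_sq_mul_sq _ _ _

theorem rankOne_eq_zero_of_vecNormSq_eq_zero {v : n → ℂ} (h : vecNormSq v = 0) :
    rankOne v = 0 := by
  rw [← (rankOne_posSemidef v).trace_eq_zero_iff, trace_rankOne, h, Complex.ofReal_zero]

/-- The symmetrized product of two rank one effects becomes positive after adding suitable
multiples of them. -/
theorem posSemidef_anticommutator_add {p q : ℝ} (hp : 0 ≤ p) (hq : 0 ≤ q) (v w : n → ℂ)
    (h : ‖star v ⬝ᵥ w‖ ^ 2 ≤ p * q) :
    (rankOne v * rankOne w + rankOne w * rankOne v + (p • rankOne v + q • rankOne w)).PosSemidef := by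
  have hv := (rankOne_posSemidef v).isHermitian
  have hw := (rankOne_posSemidef w).isHermitian
  refine .of_dotProduct_mulVec_nonneg ?_ fun z => ?_
  · refine IsHermitian.add ?_ (((rankOne_posSemidef v).smul hp).isHermitian.add
      ((rankOne_posSemidef w).smul hq).isHermitian)
    rw [IsHermitian, conjTranspose_add, conjTranspose_mul, conjTranspose_mul, hv.eq, hw.eq,
      add_comm]
  · have e1 : star z ⬝ᵥ ((rankOne w * rankOne v) *ᵥ z) =
        star (star z ⬝ᵥ ((rankOne v * rankOne w) *ᵥ z)) := by
      rw [dotProduct_rankOne_mul_rankOne_mulVec, dotProduct_rankOne_mul_rankOne_mulVec]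
      rw [star_mul', star_mul', ← star_dotProduct, ← star_dotProduct, ← star_dotProduct]
      ring
    simp only [add_mulVec, dotProduct_add, smul_mulVec, dotProduct_smul,
      dotProduct_rankOne_mulVec, e1]
    set c := star z ⬝ᵥ ((rankOne v * rankOne w) *ᵥ z) with hc
    have hcn : ‖c‖ = ‖star v ⬝ᵥ w‖ * ‖star v ⬝ᵥ z‖ * ‖star w ⬝ᵥ z‖ := by
      rw [hc, dotProduct_rankOne_mul_rankOne_mulVec, norm_mul, norm_mul,
        norm_star_dotProduct_comm z v]
    set x := ‖star v ⬝ᵥ w‖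
    set a := ‖star v ⬝ᵥ z‖
    set b := ‖star w ⬝ᵥ z‖
    have key : 0 ≤ 2 * c.re + (p * a ^ 2 + q * b ^ 2) := by
      have h1 : -(x * a * b) ≤ c.re := by
        rw [← hcn]; exact (abs_le.1 (Complex.abs_re_le_norm c)).1
      -- AM-GM: `2xab ≤ 2(√p a)(√q b) ≤ pa² + qb²`.
      have h2 : x ≤ √p * √q := by
        rw [← Real.sqrt_mul hp]; exact Real.le_sqrt_of_sq_le h
      have h3 : x * (a * b) ≤ √p * √q * (a * b) := by gcongr
      nlinarith [sq_nonneg (√p * a - √q * b), Real.sq_sqrt hp, Real.sq_sqrt hq]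
    have : c + star c + (p • ((a ^ 2 : ℝ) : ℂ) + q • ((b ^ 2 : ℝ) : ℂ)) =
        ((2 * c.re + (p * a ^ 2 + q * b ^ 2) : ℝ) : ℂ) := by
      rw [← starRingEnd_apply, Complex.add_conj]
      simp
    rw [this]
    exact_mod_cast key

/-- The weight of `rankOne v` in the universal joint measurement of `rankOne v` and `rankOne w`. -/
def jointWeight (v w : n → ℂ) : ℝ :=
  √(Fintype.card n) / 2 *
    (‖star v ⬝ᵥ w‖ ^ 2 / vecNormSq v + vecNormSq w / Fintype.card n)

theorem jointWeight_nonneg (v w : n → ℂ) : 0 ≤ jointWeight v w := by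
  have := vecNormSq_nonneg v
  have := vecNormSq_nonneg w
  rw [jointWeight]
  positivity

/-- With `x = |⟨v,w⟩|²`, `a = ‖v‖²`, `b = ‖w‖²`, the product of the weights is `(D/4) ab (x/(ab) +
1/D)²`, which exceeds `x` by the same expression with a minus sign in the square. -/
theorem norm_sq_le_jointWeight_mul [Nonempty n] (v w : n → ℂ) :
    ‖star v ⬝ᵥ w‖ ^ 2 ≤ jointWeight v w * jointWeight w v := by
  have hv := vecNormSq_nonneg v
  have hw := vecNormSq_nonneg w
  have hle := norm_star_dotProduct_sq_le v w
  have hD : (0 : ℝ) < Fintype.card n := by exact_mod_cast Fintype.card_pos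
  -- If a vector vanishes, the quotients in the weights are division by zero, but then the overlap
  -- is zero by Cauchy-Schwarz.
  rcases (mul_nonneg hv hw).eq_or_lt with h0 | h0
  · rw [← h0] at hle
    exact hle.trans (mul_nonneg (jointWeight_nonneg _ _) (jointWeight_nonneg _ _))
  · have hv' : vecNormSq v ≠ 0 := fun h => by simp [h] at h0
    have hw' : vecNormSq w ≠ 0 := fun h => by simp [h] at h0
    have hs : √(Fintype.card n : ℝ) * √(Fintype.card n : ℝ) = Fintype.card n :=
      Real.mul_self_sqrt hD.le
    rw [jointWeight, jointWeight, norm_star_dotProduct_comm w v]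
    generalize ‖star v ⬝ᵥ w‖ ^ 2 = x at *
    generalize vecNormSq v = a at *
    generalize vecNormSq w = b at *
    generalize (Fintype.card n : ℝ) = D at *
    have e : √D / 2 * (x / a + b / D) * (√D / 2 * (x / b + a / D)) =
        x + D / 4 * (a * b) * (x / (a * b) - 1 / D) ^ 2 := by
      calc _ = (√D * √D) / 4 * ((x / a + b / D) * (x / b + a / D)) := by ring
        _ = _ := by rw [hs]; field_simp; ring
    rw [e]
    have : 0 ≤ D / 4 * (a * b) * (x / (a * b) - 1 / D) ^ 2 := by positivity
    linarith

/-- The effect of the universal joint measurement belonging to the rank one effects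
`rankOne v` and `rankOne w`. -/
def jointEffect (v w : n → ℂ) : Matrix n n ℂ :=
  (2 * (1 + √(Fintype.card n)))⁻¹ • (rankOne v * rankOne w + rankOne w * rankOne v +
    (jointWeight v w • rankOne v + jointWeight w v • rankOne w))

theorem jointEffect_comm (v w : n → ℂ) : jointEffect v w = jointEffect w v := by
  rw [jointEffect, jointEffect, add_comm (rankOne v * _), add_comm (jointWeight v w • _)]

theorem jointEffect_posSemidef [Nonempty n] (v w : n → ℂ) : (jointEffect v w).PosSemidef :=
  (posSemidef_anticommutator_add (jointWeight_nonneg _ _) (jointWeight_nonneg _ _) v w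
    (norm_sq_le_jointWeight_mul v w)).smul (by positivity)

variable [DecidableEq n]

section Resolution

variable {J : Type*} [Fintype J] {w : J → n → ℂ}

theorem sum_norm_sq_of_sum_rankOne (hw : ∑ j, rankOne (w j) = 1) (z : n → ℂ) :
    ∑ j, ‖star (w j) ⬝ᵥ z‖ ^ 2 = vecNormSq z := by
  have h := congrArg (fun A => star z ⬝ᵥ (A *ᵥ z)) hw
  simp only [sum_mulVec, dotProduct_sum, dotProduct_rankOne_mulVec, one_mulVec,
    star_dotProduct_self_eq] at h
  exact_mod_cast h

theorem sum_vecNormSq_of_sum_rankOne (hw : ∑ j, rankOne (w j) = 1) :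
    ∑ j, vecNormSq (w j) = Fintype.card n := by
  have h := congrArg trace hw
  simp only [trace_sum, trace_rankOne, trace_one] at h
  exact_mod_cast h

theorem star_dotProduct_eq_sum_of_sum_rankOne (hw : ∑ j, rankOne (w j) = 1) (v z : n → ℂ) :
    star v ⬝ᵥ z = ∑ j, (star v ⬝ᵥ w j) * (star (w j) ⬝ᵥ z) := by
  have h := congrArg (fun A => star v ⬝ᵥ (A *ᵥ z)) hw
  simp only [sum_mulVec, dotProduct_sum, one_mulVec] at h
  rw [← h]
  refine Finset.sum_congr rfl fun j _ => ?_
  rw [rankOne, vecMulVec_mulVec, dotProduct_smul, op_smul_eq_mul,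
    mul_comm]

/-- A weighted resolution of the identity dominates a rank one operator. -/
theorem posSemidef_smul_sum_sub_rankOne (hw : ∑ j, rankOne (w j) = 1) {v : n → ℂ} {p q : J → ℝ}
    (hp : ∀ j, 0 ≤ p j) (hq : ∀ j, 0 ≤ q j) (h : ∀ j, ‖star v ⬝ᵥ w j‖ ^ 2 ≤ p j * q j)
    {s : ℝ} (hs : ∑ j, p j ≤ s) :
    (s • ∑ j, q j • rankOne (w j) - rankOne v).PosSemidef := by
  have hs0 : 0 ≤ s := (Finset.sum_nonneg fun j _ => hp j).trans hs
  have hS : (∑ j, q j • rankOne (w j)).PosSemidef :=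
    posSemidef_sum _ fun j _ => (rankOne_posSemidef _).smul (hq j)
  refine .of_dotProduct_mulVec_nonneg
    ((hS.smul hs0).isHermitian.sub (rankOne_posSemidef v).isHermitian) fun z => ?_
  simp only [sub_mulVec, dotProduct_sub, smul_mulVec, dotProduct_smul, sum_mulVec, dotProduct_sum,
      dotProduct_rankOne_mulVec]
  have key : ‖star v ⬝ᵥ z‖ ^ 2 ≤ s * ∑ j, q j * ‖star (w j) ⬝ᵥ z‖ ^ 2 := by
    have h1 : ‖star v ⬝ᵥ z‖ ≤ ∑ j, ‖star v ⬝ᵥ w j‖ * ‖star (w j) ⬝ᵥ z‖ := by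
      rw [star_dotProduct_eq_sum_of_sum_rankOne hw]
      exact (norm_sum_le _ _).trans (le_of_eq (by simp))
    -- Cauchy-Schwarz, splitting each factor `‖⟨v, w j⟩‖` as `√(p j) √(q j)`.
    calc ‖star v ⬝ᵥ z‖ ^ 2 ≤ (∑ j, ‖star v ⬝ᵥ w j‖ * ‖star (w j) ⬝ᵥ z‖) ^ 2 := by gcongr
      _ ≤ (∑ j, p j) * ∑ j, q j * ‖star (w j) ⬝ᵥ z‖ ^ 2 := by
        refine Finset.sum_sq_le_sum_mul_sum_of_sq_le_mul _ (fun j _ => hp j)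
          (fun j _ => mul_nonneg (hq j) (by positivity)) fun j _ => ?_
        rw [mul_pow, ← mul_assoc]
        exact mul_le_mul_of_nonneg_right (h j) (by positivity)
      _ ≤ _ := by
        refine mul_le_mul_of_nonneg_right hs (Finset.sum_nonneg fun j _ => ?_)
        exact mul_nonneg (hq j) (by positivity)
  have : s • ∑ j, q j • ((‖star (w j) ⬝ᵥ z‖ ^ 2 : ℝ) : ℂ) - ((‖star v ⬝ᵥ z‖ ^ 2 : ℝ) : ℂ) =
      ((s * (∑ j, q j * ‖star (w j) ⬝ᵥ z‖ ^ 2) - ‖star v ⬝ᵥ z‖ ^ 2 : ℝ) : ℂ) := by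
    simp
  rw [this]
  exact_mod_cast sub_nonneg.2 key

end Resolution

/-! ### Marginals of the universal joint measurement -/

section Joint

variable {J : Type*} [Fintype J] {w : J → n → ℂ}

/-- Both halves of the weight sum to `√D / 2`, except that for `v = 0` the first half is `0`; hence
only an inequality. -/
theorem sum_jointWeight_le [Nonempty n] (hw : ∑ j, rankOne (w j) = 1) (v : n → ℂ) :
    ∑ j, jointWeight v (w j) ≤ √(Fintype.card n) := by
  have hD : (0 : ℝ) < Fintype.card n := by exact_mod_cast Fintype.card_pos
  simp only [jointWeight, norm_star_dotProduct_comm v]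
  rw [← Finset.mul_sum, Finset.sum_add_distrib, ← Finset.sum_div, ← Finset.sum_div,
    sum_norm_sq_of_sum_rankOne hw, sum_vecNormSq_of_sum_rankOne hw, div_self hD.ne']
  have := div_self_le_one (vecNormSq v)
  nlinarith [Real.sqrt_nonneg (Fintype.card n : ℝ)]

/-- Multiplying by `rankOne v` removes the exception `v = 0`, so equality holds here. -/
theorem sum_jointWeight_smul [Nonempty n] (hw : ∑ j, rankOne (w j) = 1) (v : n → ℂ) :
    ∑ j, jointWeight v (w j) • rankOne v = √(Fintype.card n) • rankOne v := by
  rw [← Finset.sum_smul]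
  rcases eq_or_ne (vecNormSq v) 0 with h | h
  · simp [rankOne_eq_zero_of_vecNormSq_eq_zero h]
  · have hD : (0 : ℝ) < Fintype.card n := by exact_mod_cast Fintype.card_pos
    congr 1
    simp only [jointWeight, norm_star_dotProduct_comm v]
    rw [← Finset.mul_sum, Finset.sum_add_distrib, ← Finset.sum_div, ← Finset.sum_div,
      sum_norm_sq_of_sum_rankOne hw, sum_vecNormSq_of_sum_rankOne hw, div_self hD.ne', div_self h]
    ring

theorem sum_jointEffect [Nonempty n] (hw : ∑ j, rankOne (w j) = 1) (v : n → ℂ) :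
    ∑ j, jointEffect v (w j) = (2 * (1 + √(Fintype.card n)))⁻¹ •
      ((2 + √(Fintype.card n)) • rankOne v + ∑ j, jointWeight (w j) v • rankOne (w j)) := by
  simp only [jointEffect]
  rw [← Finset.smul_sum, Finset.sum_add_distrib, Finset.sum_add_distrib, Finset.sum_add_distrib,
    ← Finset.mul_sum, ← Finset.sum_mul, hw, sum_jointWeight_smul hw, mul_one, one_mul, add_smul,
    two_smul]
  abel_nf

theorem sum_sum_jointEffect [Nonempty n] {I : Type*} [Fintype I] {v : I → n → ℂ}
    (hv : ∑ i, rankOne (v i) = 1) (hw : ∑ j, rankOne (w j) = 1) :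
    ∑ i, ∑ j, jointEffect (v i) (w j) = 1 := by
  simp only [sum_jointEffect hw]
  rw [← Finset.smul_sum, Finset.sum_add_distrib, ← Finset.smul_sum, hv, Finset.sum_comm]
  simp only [sum_jointWeight_smul hv]
  rw [← Finset.smul_sum, hw, ← add_smul, smul_smul]
  have : (2 * (1 + √(Fintype.card n : ℝ)))⁻¹ * (2 + √(Fintype.card n : ℝ) + √(Fintype.card n : ℝ))
      = 1 := by
    have : 0 ≤ √(Fintype.card n : ℝ) := Real.sqrt_nonneg _
    field_simp
    ring
  rw [this, one_smul]

/-- The factor `1 + s` for the robustness `s` of a pair of mutually unbiased bases of a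
`D`-dimensional space. -/
def unbiasedFactor (D : ℝ) : ℝ := 2 * √D / (1 + √D)

/-- With `S = ∑ j, jointWeight (w j) v • rankOne (w j)`, the coefficients combine so that the
difference is exactly `(√D S - rankOne v) / (1 + √D)²`, and `rankOne v ≤ √D S` by
`posSemidef_smul_sum_sub_rankOne`. -/
theorem posSemidef_smul_sum_jointEffect_sub [Nonempty n] (hw : ∑ j, rankOne (w j) = 1)
    (v : n → ℂ) :
    (unbiasedFactor (Fintype.card n) • ∑ j, jointEffect v (w j) - rankOne v).PosSemidef := by
  have h := (posSemidef_smul_sum_sub_rankOne hw (v := v) (fun j => jointWeight_nonneg v (w j))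
    (fun j => jointWeight_nonneg (w j) v) (fun j => norm_sq_le_jointWeight_mul v (w j))
    (sum_jointWeight_le hw v)).smul
      (a := ((1 + √(Fintype.card n : ℝ)) ^ 2)⁻¹) (by positivity)
  convert h using 1
  rw [sum_jointEffect hw, unbiasedFactor]
  have : 0 ≤ √(Fintype.card n : ℝ) := Real.sqrt_nonneg _
  generalize √(Fintype.card n : ℝ) = r at *
  generalize ∑ j, jointWeight (w j) v • rankOne (w j) = S
  match_scalars <;> field_simp
  ring

end Joint

end RankOne

end

noncomputable section

/-! ### The universal noise level -/

section Robustness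

open Matrix

variable {n : Type*} [Fintype n] [DecidableEq n]

open scoped MatrixOrder Matrix.Norms.L2Operator in
/-- A positive operator is a sum of rank one operators. -/
theorem exists_sum_rankOne_eq {A : Matrix n n ℂ} (hA : A.PosSemidef) :
    ∃ v : n → n → ℂ, ∑ k, rankOne (v k) = A := by
  obtain ⟨B, rfl⟩ := CStarAlgebra.nonneg_iff_eq_star_mul_self.mp hA.nonneg
  refine ⟨fun k i => star (B k i), ?_⟩
  ext i j
  rw [Matrix.sum_apply]
  simp [rankOne, vecMulVec_apply, mul_apply, star_eq_conjTranspose]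

/-- A measurement set with a joint measurement is compatible. -/
theorem isCompatible_of_joint {X O L n : Type*} [DecidableEq n] [Fintype O] [Fintype L]
    {M : X → O → Matrix n n ℂ} (G : L → Matrix n n ℂ) (f : X → L → O)
    (hG : ∀ l, (G l).PosSemidef) (hsum : ∑ l, G l = 1)
    (hM : ∀ x a, M x a = ∑ l, if f x l = a then G l else 0) : IsCompatible M := by
  let e := Fintype.equivFin L
  refine ⟨Fintype.card L, fun l => G (e.symm l), fun x l a => if f x (e.symm l) = a then 1 else 0,
    fun l => hG _, ?_, fun x l a => by dsimp only; split_ifs <;> simp, fun x l => by simp, fun x a => ?_⟩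
  · rw [e.symm.sum_comp G, hsum]
  · rw [hM, ← e.symm.sum_comp]
    simp [ite_smul]

/-- Sufficient condition for a noise level to make a measurement set compatible: up to the factor
`1 + s`, the effects are dominated by those of a compatible measurement set. -/
theorem mem_robustnessSet_of_posSemidef_sub {X O : Type*} [Fintype O]
    {M F : X → O → Matrix n n ℂ} (hM : IsMeasurementSet M) (hF : IsCompatible F)
    (hFsum : ∀ x, ∑ a, F x a = 1) {s : ℝ≥0}
    (h : ∀ x a, ((1 + (s : ℝ)) • F x a - M x a).PosSemidef) : s ∈ robustnessSet M := by
  have hs0 : 0 < 1 + (s : ℝ) := by positivity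
  -- At `s = 0` there is no excess to normalize: the differences `F x a - M x a` are positive with
  -- total trace zero, so `F = M` and any `K` will do.
  rcases eq_or_ne s 0 with rfl | hs
  · refine ⟨M, hM, ?_⟩
    convert hF using 3 with x a
    have hz : ∀ x a, F x a = M x a := fun x a => by
      have h0 : ∑ a, (F x a - M x a).trace = 0 := by
        rw [← trace_sum, Finset.sum_sub_distrib, hFsum, hM.2, sub_self, trace_zero]
      have hp : ∀ a, (F x a - M x a).PosSemidef := fun a => by simpa using h x a
      have := (Finset.sum_eq_zero_iff_of_nonneg fun a _ => (hp a).trace_nonneg).1 h0 a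
        (Finset.mem_univ a)
      exact sub_eq_zero.1 ((hp a).trace_eq_zero_iff.1 this)
    simp [hz]
  · have hs' : (s : ℝ) ≠ 0 := by exact_mod_cast hs
    -- The noise is the normalized excess, which makes the mixture equal to `F`.
    refine ⟨fun x a => (s : ℝ)⁻¹ • ((1 + (s : ℝ)) • F x a - M x a),
      ⟨fun x a => (h x a).smul (by positivity), fun x => ?_⟩, ?_⟩
    · rw [← Finset.smul_sum, Finset.sum_sub_distrib, ← Finset.smul_sum, hFsum, hM.2, add_smul,
        one_smul, add_sub_cancel_left, smul_smul, inv_mul_cancel₀ hs', one_smul]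
    · convert hF using 3 with x a
      rw [smul_smul, mul_inv_cancel₀ hs', one_smul, add_sub_cancel, smul_smul,
        inv_mul_cancel₀ hs0.ne', one_smul]

/-- The robustness of a pair of mutually unbiased bases of a `D`-dimensional space. -/
def unbiasedRobustness (D : ℝ) : ℝ≥0 := Real.toNNReal (unbiasedFactor D - 1)

theorem one_add_unbiasedRobustness {D : ℝ} (hD : 1 ≤ D) :
    1 + (unbiasedRobustness D : ℝ) = unbiasedFactor D := by
  have h1 : 1 ≤ √D := Real.one_le_sqrt.2 hD
  have : 1 ≤ unbiasedFactor D := by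
    rw [unbiasedFactor, one_le_div (by positivity)]
    linarith
  rw [unbiasedRobustness, Real.coe_toNNReal _ (by linarith)]
  ring

/-- The robustness of unbiased bases is a universal noise level: it makes every pair of
measurements compatible. -/
theorem unbiasedRobustness_mem_robustnessSet [Nonempty n] {O : Type*} [Fintype O]
    {M : Fin 2 → O → Matrix n n ℂ} (hM : IsMeasurementSet M) :
    unbiasedRobustness (Fintype.card n) ∈ robustnessSet M := by
  choose v hv using fun x a => exists_sum_rankOne_eq (hM.1 x a)
  have hres : ∀ x, ∑ i : O × n, rankOne (v x i.1 i.2) = 1 := fun x => by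
    rw [Fintype.sum_prod_type]
    simp only [hv, hM.2]
  -- The marginals of the parent POVM indexed by pairs of rank one labels; each keeps the outcome of
  -- one label and forgets the rest. Symmetry of `jointEffect` lets the second marginal reuse the
  -- lemmas for the first.
  let F : Fin 2 → O → Matrix n n ℂ := ![
    fun a => ∑ k, ∑ j : O × n, jointEffect (v 0 a k) (v 1 j.1 j.2),
    fun b => ∑ l, ∑ i : O × n, jointEffect (v 1 b l) (v 0 i.1 i.2)]
  have hFsum : ∀ x, ∑ a, F x a = 1 := fun x => by
    fin_cases x
    · rw [← sum_sum_jointEffect (hres 0) (hres 1), Fintype.sum_prod_type]; rfl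
    · rw [← sum_sum_jointEffect (hres 1) (hres 0), Fintype.sum_prod_type]; rfl
  refine mem_robustnessSet_of_posSemidef_sub (F := F) hM ?_ hFsum fun x a => ?_
  · refine isCompatible_of_joint
      (fun l : (O × n) × (O × n) => jointEffect (v 0 l.1.1 l.1.2) (v 1 l.2.1 l.2.2))
      (![fun l => l.1.1, fun l => l.2.1]) (fun l => jointEffect_posSemidef _ _) ?_ fun x a => ?_
    · rw [Fintype.sum_prod_type, sum_sum_jointEffect (hres 0) (hres 1)]
    · fin_cases x
      · simp [F, Fintype.sum_prod_type]
      · have e : ∑ l, ∑ c, ∑ k, jointEffect (v 1 a l) (v 0 c k) =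
            ∑ c, ∑ k, ∑ l, jointEffect (v 0 c k) (v 1 a l) := by
          rw [Finset.sum_comm]
          refine Finset.sum_congr rfl fun c _ => ?_
          rw [Finset.sum_comm]
          simp only [jointEffect_comm]
        simpa [F, Fintype.sum_prod_type] using e
  · rw [one_add_unbiasedRobustness (by exact_mod_cast Fintype.card_pos (α := n))]
    fin_cases x
    · have := posSemidef_sum Finset.univ fun k _ =>
        posSemidef_smul_sum_jointEffect_sub (hres 1) (v 0 a k)
      rwa [Finset.sum_sub_distrib, ← Finset.smul_sum, hv] at this
    · have := posSemidef_sum Finset.univ fun k _ =>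
        posSemidef_smul_sum_jointEffect_sub (hres 0) (v 1 a k)
      rwa [Finset.sum_sub_distrib, ← Finset.smul_sum, hv] at this

/-! ### The witness bound -/

/-- A sum of two projectors onto unit vectors is at most `1 + |⟨v, w⟩|`. -/
theorem posSemidef_smul_one_sub_rankOne_add {v w : n → ℂ} {r : ℝ} (hv : vecNormSq v = 1)
    (hw : vecNormSq w = 1) (hr : ‖star v ⬝ᵥ w‖ ≤ r) :
    ((1 + r) • (1 : Matrix n n ℂ) - (rankOne v + rankOne w)).PosSemidef := by
  have hr0 : 0 ≤ r := (norm_nonneg _).trans hr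
  refine .of_dotProduct_mulVec_nonneg
    (((PosSemidef.one (n := n) (R := ℂ)).smul (by positivity : 0 ≤ 1 + r)).isHermitian.sub
      ((rankOne_posSemidef v).add (rankOne_posSemidef w)).isHermitian) fun z => ?_
  simp only [sub_mulVec, dotProduct_sub, smul_mulVec, dotProduct_smul, add_mulVec, dotProduct_add,
      dotProduct_rankOne_mulVec, one_mulVec, star_dotProduct_self_eq]
  have key : ‖star v ⬝ᵥ z‖ ^ 2 + ‖star w ⬝ᵥ z‖ ^ 2 ≤ (1 + r) * vecNormSq z := by
    -- Put `y = αv + βw` and `T = |α|² + |β|²`. Then `⟨z,y⟩ = T` and `‖y‖² ≤ (1 + r)T`, so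
    -- Cauchy-Schwarz gives `T² ≤ ‖z‖²(1 + r)T`; cancel `T`.
    set α := star v ⬝ᵥ z with hα
    set β := star w ⬝ᵥ z with hβ
    have hα' : star z ⬝ᵥ v = star α := by rw [hα, ← star_dotProduct]
    have hβ' : star z ⬝ᵥ w = star β := by rw [hβ, ← star_dotProduct]
    have h1 : ‖star z ⬝ᵥ (α • v + β • w)‖ = ‖α‖ ^ 2 + ‖β‖ ^ 2 := by
      have : star z ⬝ᵥ (α • v + β • w) = ((‖α‖ ^ 2 + ‖β‖ ^ 2 : ℝ) : ℂ) := by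
        rw [dotProduct_add, dotProduct_smul, dotProduct_smul, hα', hβ']
        push_cast
        rw [← Complex.mul_conj', ← Complex.mul_conj']
        rfl
      rw [this, Complex.norm_real, Real.norm_of_nonneg (by positivity)]
    have h2 : vecNormSq (α • v + β • w) ≤ (‖α‖ ^ 2 + ‖β‖ ^ 2) * (1 + r) := by
      have e : (vecNormSq (α • v + β • w) : ℂ) = star α * α + star β * β +
          (star α * β * (star v ⬝ᵥ w) + star (star α * β * (star v ⬝ᵥ w))) := by
        rw [← star_dotProduct_self_eq, star_add, star_smul, star_smul]
        simp only [add_dotProduct, dotProduct_add, smul_dotProduct, dotProduct_smul,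
          star_dotProduct_self_eq, hv, hw, star_mul', star_star, ← star_dotProduct, smul_eq_mul,
          Complex.ofReal_one]
        ring
      have e' : vecNormSq (α • v + β • w) =
          ‖α‖ ^ 2 + ‖β‖ ^ 2 + 2 * (star α * β * (star v ⬝ᵥ w)).re := by
        have c1 : ∀ c : ℂ, star c * c = ((‖c‖ ^ 2 : ℝ) : ℂ) := fun c => by
          rw [← starRingEnd_apply, Complex.conj_mul', Complex.ofReal_pow]
        have c2 : ∀ c : ℂ, c + star c = ((2 * c.re : ℝ) : ℂ) := Complex.add_conj
        rw [c1, c1, c2] at e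
        exact_mod_cast e
      have h3 := Complex.re_le_norm (star α * β * (star v ⬝ᵥ w))
      rw [norm_mul, norm_mul, norm_star] at h3
      have h4 : ‖α‖ * ‖β‖ * ‖star v ⬝ᵥ w‖ ≤ ‖α‖ * ‖β‖ * r := by gcongr
      nlinarith [mul_nonneg hr0 (sq_nonneg (‖α‖ - ‖β‖))]
    have h5 := norm_star_dotProduct_sq_le z (α • v + β • w)
    rw [h1] at h5
    rcases (by positivity : 0 ≤ ‖α‖ ^ 2 + ‖β‖ ^ 2).eq_or_lt with h0 | h0
    · rw [← h0]
      exact mul_nonneg (by positivity) (vecNormSq_nonneg z)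
    · have h6 := mul_le_mul_of_nonneg_left h2 (vecNormSq_nonneg z)
      refine le_of_mul_le_mul_left ?_ h0
      linarith
  have : (1 + r) • (vecNormSq z : ℂ) -
      (((‖star v ⬝ᵥ z‖ ^ 2 : ℝ) : ℂ) + ((‖star w ⬝ᵥ z‖ ^ 2 : ℝ) : ℂ)) =
      (((1 + r) * vecNormSq z - (‖star v ⬝ᵥ z‖ ^ 2 + ‖star w ⬝ᵥ z‖ ^ 2) : ℝ) : ℂ) := by
    simp
  rw [this]
  exact_mod_cast sub_nonneg.2 key

theorem trace_mul_re_nonneg {A B : Matrix n n ℂ} (hA : A.PosSemidef) (hB : B.PosSemidef) :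
    0 ≤ (A * B).trace.re := by
  obtain ⟨v, rfl⟩ := exists_sum_rankOne_eq hA
  rw [Finset.sum_mul, trace_sum, Complex.re_sum]
  refine Finset.sum_nonneg fun k _ => ?_
  have := (Complex.le_def.1 (hB.dotProduct_mulVec_nonneg (v k))).1
  rwa [rankOne, vecMulVec_mul, trace_vecMulVec, dotProduct_comm, ← dotProduct_mulVec] 

/-- Witness bound: if `Q 0 a + Q 1 b ≤ r` for all outcomes `a` and `b`, then the total overlap of
the effects of `M` with the operators `Q x a` is at most `(1 + s) r D` for every noise level `s`
that makes `M` compatible. -/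
theorem le_of_mem_robustnessSet {O : Type*} [Fintype O]
    {M Q : Fin 2 → O → Matrix n n ℂ} {r : ℝ} (hQ : ∀ x a, (Q x a).PosSemidef)
    (h : ∀ a b, (r • (1 : Matrix n n ℂ) - (Q 0 a + Q 1 b)).PosSemidef)
    {s : ℝ≥0} (hs : s ∈ robustnessSet M) :
    ∑ x, ∑ a, (M x a * Q x a).trace.re ≤ (1 + (s : ℝ)) * (r * Fintype.card n) := by
  obtain ⟨K, hK, m, G, p, hG, hG1, hp, hp1, hc⟩ := hs
  have hs0 : 0 < 1 + (s : ℝ) := by positivity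
  have hM : ∀ x a, M x a + (s : ℝ) • K x a = (1 + (s : ℝ)) • ∑ l, p x l a • G l := fun x a => by
    rw [← hc, smul_smul, mul_inv_cancel₀ hs0.ne', one_smul]
  -- The noise `K` has nonnegative overlap with `Q` and is dropped.
  have hle : ∀ x a, (M x a * Q x a).trace.re ≤
      (1 + (s : ℝ)) * ∑ l, p x l a * (G l * Q x a).trace.re := fun x a => by
    have h1 := congrArg (fun A => (A * Q x a).trace.re) (hM x a)
    simp only [add_mul, trace_add, Complex.add_re, smul_mul_assoc, trace_smul, Complex.smul_re,
      Finset.sum_mul, trace_sum, Complex.re_sum, smul_eq_mul] at h1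
    have := mul_nonneg s.coe_nonneg (trace_mul_re_nonneg (hK.1 x a) (hQ x a))
    linarith
  have hl : ∀ l, ∑ x, ∑ a, p x l a * (G l * Q x a).trace.re ≤ r * (G l).trace.re := fun l => by
    have hab : ∀ a b, (G l * Q 0 a).trace.re + (G l * Q 1 b).trace.re ≤ r * (G l).trace.re :=
      fun a b => by
        have := trace_mul_re_nonneg (hG l) (h a b)
        simp only [mul_sub, mul_add, trace_sub, trace_add, Complex.sub_re, Complex.add_re,
          mul_smul_comm, trace_smul, Complex.smul_re, mul_one, smul_eq_mul] at this
        linarith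
    -- Average the bound for pairs `(a, b)` over the product distribution, whose marginals are the
    -- two response functions.
    have h2 : ∑ a, ∑ b, p 0 l a * p 1 l b *
        ((G l * Q 0 a).trace.re + (G l * Q 1 b).trace.re) ≤
        ∑ a, ∑ b, p 0 l a * p 1 l b * (r * (G l).trace.re) :=
      Finset.sum_le_sum fun a _ => Finset.sum_le_sum fun b _ =>
        mul_le_mul_of_nonneg_left (hab a b) (mul_nonneg (hp _ _ _) (hp _ _ _))
    have e1 : ∑ a, ∑ b, p 0 l a * p 1 l b * (r * (G l).trace.re) = r * (G l).trace.re := by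
      simp only [← Finset.sum_mul, ← Finset.mul_sum, hp1, one_mul]
    have e2 : ∑ a, ∑ b, p 0 l a * p 1 l b *
        ((G l * Q 0 a).trace.re + (G l * Q 1 b).trace.re) =
        ∑ a, p 0 l a * (G l * Q 0 a).trace.re + ∑ b, p 1 l b * (G l * Q 1 b).trace.re := by
      simp only [mul_add, Finset.sum_add_distrib]
      congr 1
      · refine Finset.sum_congr rfl fun a _ => ?_
        rw [← Finset.sum_mul, ← Finset.mul_sum, hp1, mul_one]
      · rw [Finset.sum_comm]
        refine Finset.sum_congr rfl fun b _ => ?_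
        rw [← Finset.sum_mul, ← Finset.sum_mul, hp1, one_mul]
    rw [Fin.sum_univ_two, ← e2, ← e1]
    exact h2
  calc ∑ x, ∑ a, (M x a * Q x a).trace.re
      ≤ ∑ x, ∑ a, (1 + (s : ℝ)) * ∑ l, p x l a * (G l * Q x a).trace.re :=
        Finset.sum_le_sum fun x _ => Finset.sum_le_sum fun a _ => hle x a
    _ = (1 + (s : ℝ)) * ∑ l, ∑ x, ∑ a, p x l a * (G l * Q x a).trace.re := by
        simp only [← Finset.mul_sum]
        congr 1
        rw [Finset.sum_comm (s := (Finset.univ : Finset (Fin m)))]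
        exact Finset.sum_congr rfl fun x _ => Finset.sum_comm
    _ ≤ (1 + (s : ℝ)) * ∑ l, r * (G l).trace.re :=
        mul_le_mul_of_nonneg_left (Finset.sum_le_sum fun l _ => hl l) hs0.le
    _ = _ := by
        rw [← Finset.mul_sum, ← Complex.re_sum, ← trace_sum, hG1, trace_one, Complex.natCast_re]

end Robustness

end

noncomputable section

/-! ### Unbiased bases attain the universal noise level -/

section UnbiasedPair

open Matrix

variable {n : Type*} [Fintype n] {u : Fin 2 → n → EuclideanSpace ℂ n}

theorem IsUnbiasedPair.norm_dotProduct_sq (hu : IsUnbiasedPair u) (x y : Fin 2) (a b : n) :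
    ‖star (u x a).ofLp ⬝ᵥ (u y b).ofLp‖ ^ 2 =
      if x = y then (if a = b then (1 : ℝ) else 0) else 1 / (Fintype.card n : ℝ) := by
  rw [← hu x y a b, EuclideanSpace.inner_eq_star_dotProduct, dotProduct_comm]

theorem IsUnbiasedPair.vecNormSq_eq_one (hu : IsUnbiasedPair u) (x : Fin 2) (a : n) :
    vecNormSq (u x a).ofLp = 1 := by
  have h := hu.norm_dotProduct_sq x x a a
  rw [star_dotProduct_self_eq, Complex.norm_real, Real.norm_of_nonneg (vecNormSq_nonneg _)] at h
  have h1 := vecNormSq_nonneg (u x a).ofLp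
  simp only [if_true] at h
  nlinarith

theorem IsUnbiasedPair.star_dotProduct (hu : IsUnbiasedPair u) (x : Fin 2) (a b : n) :
    star (u x a).ofLp ⬝ᵥ (u x b).ofLp = if a = b then 1 else 0 := by
  split_ifs with h
  · rw [h, star_dotProduct_self_eq, hu.vecNormSq_eq_one, Complex.ofReal_one]
  · have := hu.norm_dotProduct_sq x x a b
    simpa [h] using this

theorem IsUnbiasedPair.sum_rankOne [DecidableEq n] (hu : IsUnbiasedPair u) (x : Fin 2) :
    ∑ a, rankOne (u x a).ofLp = 1 := by
  let B : Matrix n n ℂ := of fun i a => u x a i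
  have h : Bᴴ * B = 1 := by
    ext a b
    have := hu.star_dotProduct x a b
    simp only [dotProduct, Pi.star_apply] at this
    simp only [mul_apply, conjTranspose_apply, B, of_apply, this]
    by_cases hab : a = b <;> simp [hab, one_apply]
  -- Orthonormality becomes completeness because `B` is square.
  rw [mul_eq_one_comm] at h
  rw [← h]
  ext i j
  rw [Matrix.sum_apply]
  simp [B, rankOne, vecMulVec_apply, mul_apply]

variable [DecidableEq n]

theorem IsUnbiasedPair.isMeasurementSet (hu : IsUnbiasedPair u) :
    IsMeasurementSet (rankOneMeasurement u) :=
  ⟨fun x a => rankOne_posSemidef (u x a).ofLp, hu.sum_rankOne⟩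

/-- The relabelling `f` and scale `c` cover reductions, which keep all `d ^ N` outcomes and so
repeat each projector with a small weight. The witness consists of the unscaled projectors; each
overlap is `c`, so the total is `2D`. -/
theorem IsUnbiasedPair.unbiasedRobustness_le [Nonempty n] (hu : IsUnbiasedPair u)
    {O : Type*} [Fintype O] {M : Fin 2 → O → Matrix n n ℂ} {f : O → n} {c : ℝ}
    (hM : ∀ x a, M x a = c • rankOne (u x (f a)).ofLp) (hc : c * Fintype.card O = Fintype.card n)
    {s : ℝ≥0} (hs : s ∈ robustnessSet M) : unbiasedRobustness (Fintype.card n) ≤ s := by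
  have hD : (1 : ℝ) ≤ Fintype.card n := by exact_mod_cast Fintype.card_pos (α := n)
  have h := le_of_mem_robustnessSet (Q := fun x a => rankOne (u x (f a)).ofLp)
    (r := 1 + (√(Fintype.card n))⁻¹) (fun x a => rankOne_posSemidef _) (fun a b => by
      refine posSemidef_smul_one_sub_rankOne_add (hu.vecNormSq_eq_one _ _)
        (hu.vecNormSq_eq_one _ _) ?_
      rw [← Real.sqrt_inv]
      refine Real.le_sqrt_of_sq_le (le_of_eq ?_)
      rw [hu.norm_dotProduct_sq]
      simp) hs
  have ht : ∀ x a, (M x a * rankOne (u x (f a)).ofLp).trace.re = c := fun x a => by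
    rw [hM, smul_mul_assoc, rankOne_mul_rankOne, hu.star_dotProduct, if_pos rfl, one_smul,
      trace_smul]
    change (c • (rankOne (u x (f a)).ofLp).trace).re = c
    rw [trace_rankOne, hu.vecNormSq_eq_one]
    simp
  simp only [ht, Finset.sum_const, Finset.card_univ, nsmul_eq_mul, Fintype.card_fin] at h
  rw [mul_comm _ c, hc] at h
  rw [← NNReal.coe_le_coe, ← add_le_add_iff_left 1, one_add_unbiasedRobustness hD,
    unbiasedFactor]
  have h1 : 1 ≤ √(Fintype.card n : ℝ) := Real.one_le_sqrt.2 hD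
  have h2 : √(Fintype.card n : ℝ) ^ 2 = Fintype.card n := Real.sq_sqrt (by linarith)
  generalize (Fintype.card n : ℝ) = D at *
  have h3 : (2 : ℝ) ≤ (1 + s) * (1 + (√D)⁻¹) := by
    refine le_of_mul_le_mul_right ?_ (by linarith : 0 < D)
    rw [mul_assoc]
    exact_mod_cast h
  rw [div_le_iff₀ (by positivity)]
  calc 2 * √D ≤ (1 + s) * (1 + (√D)⁻¹) * √D := by gcongr
    _ = _ := by field_simp; ring

theorem genRobustness_le_unbiasedRobustness [Nonempty n] {O : Type*} [Fintype O]
    {M : Fin 2 → O → Matrix n n ℂ} (hM : IsMeasurementSet M) :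
    genRobustness M ≤ unbiasedRobustness (Fintype.card n) :=
  csInf_le' (unbiasedRobustness_mem_robustnessSet hM)

theorem IsUnbiasedPair.genRobustness_eq [Nonempty n] (hu : IsUnbiasedPair u)
    {O : Type*} [Fintype O] {M : Fin 2 → O → Matrix n n ℂ} {f : O → n} {c : ℝ}
    (hMM : IsMeasurementSet M)
    (hM : ∀ x a, M x a = c • rankOne (u x (f a)).ofLp) (hc : c * Fintype.card O = Fintype.card n) :
    genRobustness M = unbiasedRobustness (Fintype.card n) :=
  le_antisymm (genRobustness_le_unbiasedRobustness hMM)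
    (le_csInf ⟨_, unbiasedRobustness_mem_robustnessSet hMM⟩
      fun _ hs => hu.unbiasedRobustness_le hM hc hs)

end UnbiasedPair

/-! ### Tensor products and existence of unbiased bases -/

section Product

variable {S : Type*} [Fintype S] [DecidableEq S] {d : ℕ}

theorem inner_productVector (v w : S → Fin d → EuclideanSpace ℂ (Fin d)) (a b : S → Fin d) :
    inner ℂ (productVector v a) (productVector w b) = ∏ k, inner ℂ (v k (a k)) (w k (b k)) := by
  simp only [PiLp.inner_apply, productVector, Finset.prod_univ_sum, Fintype.piFinset_univ]
  refine Fintype.sum_congr _ _ fun i => ?_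
  simp [Finset.prod_mul_distrib]

theorem isUnbiasedPair_productVector {u : Fin 2 → S → Fin d → EuclideanSpace ℂ (Fin d)}
    (hu : ∀ k, IsUnbiasedPair fun x => u x k) :
    IsUnbiasedPair fun x => productVector (u x) := by
  intro x y a b
  rw [inner_productVector, norm_prod, ← Finset.prod_pow]
  rw [Finset.prod_congr rfl fun k _ => hu k x y (a k) (b k)]
  by_cases h : x = y
  · simp only [h, if_true]
    split_ifs with hab
    · simp [hab]
    · obtain ⟨k, hk⟩ := Function.ne_iff.1 hab
      exact Finset.prod_eq_zero (Finset.mem_univ k) (if_neg hk)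
  · simp [h]

/-- The standard basis and the Fourier basis are mutually unbiased. -/
theorem exists_isUnbiasedPair_zmod (m : ℕ) :
    ∃ u : Fin 2 → ZMod (m + 1) → EuclideanSpace ℂ (ZMod (m + 1)), IsUnbiasedPair u := by
  let F : ZMod (m + 1) → EuclideanSpace ℂ (ZMod (m + 1)) := fun b =>
    WithLp.toLp 2 fun j => ((√(m + 1 : ℝ))⁻¹ : ℂ) * ZMod.stdAddChar (j * b)
  let E : ZMod (m + 1) → EuclideanSpace ℂ (ZMod (m + 1)) := fun a =>
    EuclideanSpace.single a 1
  have hm : (0 : ℝ) < m + 1 := by positivity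
  have hnorm : ∀ z : ZMod (m + 1), ‖ZMod.stdAddChar z‖ = 1 := fun z => by
    rw [ZMod.stdAddChar_apply, Circle.norm_coe]
  have hEF : ∀ a b, ‖inner ℂ (E a) (F b)‖ ^ 2 = 1 / ((m + 1 : ℕ) : ℝ) := fun a b => by
    simp [E, F, EuclideanSpace.inner_single_left, hnorm, Real.sq_sqrt hm.le,
      abs_of_nonneg (Real.sqrt_nonneg _)]
  have hFF : ∀ a b, inner ℂ (F a) (F b) = if a = b then 1 else 0 := fun a b => by
    -- Orthogonality of the Fourier vectors is the vanishing of the sum of a nontrivial character.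
    have h := AddChar.sum_mulShift (b - a) (ZMod.isPrimitive_stdAddChar (m + 1))
    simp only [PiLp.inner_apply, F]
    have e : ∀ j : ZMod (m + 1), inner ℂ (((√(m + 1 : ℝ))⁻¹ : ℂ) * ZMod.stdAddChar (j * a))
        (((√(m + 1 : ℝ))⁻¹ : ℂ) * ZMod.stdAddChar (j * b)) =
        ((m + 1 : ℝ) : ℂ)⁻¹ * ZMod.stdAddChar (j * (b - a)) := fun j => by
      have h1 : (√(m + 1 : ℝ) : ℂ) * √(m + 1 : ℝ) = ((m + 1 : ℝ) : ℂ) := by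
        rw [← Complex.ofReal_mul, Real.mul_self_sqrt hm.le]
      rw [← h1, mul_sub, sub_eq_add_neg, AddChar.map_add_eq_mul, AddChar.map_neg_eq_conj]
      simp
      ring
    rw [Finset.sum_congr rfl fun j _ => e j, ← Finset.mul_sum, h]
    have hm' : (m + 1 : ℂ) ≠ 0 := by exact_mod_cast hm.ne'
    by_cases hab : a = b
    · simp [hab, hm']
    · simp [hab, sub_eq_zero, Ne.symm hab]
  refine ⟨![E, F], fun x y a b => ?_⟩
  have hEE : ∀ a b, inner ℂ (E a) (E b) = if a = b then 1 else 0 := fun a b =>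
    orthonormal_iff_ite.1 (EuclideanSpace.orthonormal_single) a b
  rw [ZMod.card]
  have hsq : ∀ a b : ZMod (m + 1), ‖(if a = b then 1 else 0 : ℂ)‖ ^ 2 =
      if a = b then (1 : ℝ) else 0 := fun a b => by split_ifs <;> simp
  fin_cases x <;> fin_cases y
  · change ‖inner ℂ (E a) (E b)‖ ^ 2 = _
    rw [hEE, hsq, if_pos rfl]
    by_cases hab : a = b <;> simp [hab]
  · exact hEF a b
  · change ‖inner ℂ (F a) (E b)‖ ^ 2 = _
    rw [norm_inner_symm]
    exact hEF b a
  · change ‖inner ℂ (F a) (F b)‖ ^ 2 = _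
    rw [hFF, hsq, if_pos rfl]
    by_cases hab : a = b <;> simp [hab]

theorem exists_isUnbiasedPair (hd : 0 < d) :
    ∃ u : Fin 2 → Fin d → EuclideanSpace ℂ (Fin d), IsUnbiasedPair u := by
  obtain ⟨m, rfl⟩ := Nat.exists_eq_succ_of_ne_zero hd.ne'
  obtain ⟨u, hu⟩ := exists_isUnbiasedPair_zmod m
  let e : ZMod (m + 1) ≃ Fin (m + 1) := (ZMod.finEquiv (m + 1)).symm.toEquiv
  refine ⟨fun x a => LinearIsometryEquiv.piLpCongrLeft 2 ℂ ℂ e (u x (e.symm a)),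
    fun x y a b => ?_⟩
  rw [LinearIsometryEquiv.inner_map_map, hu, ← Fintype.card_congr e]
  by_cases hab : a = b <;> simp [hab]

end Product

/-! ### Partial traces and reductions -/

section Reduction

open Matrix

variable {N d : ℕ}

theorem prod_mergeLabels {R : Type*} [CommMonoid R] (α : Set (Fin N)) (F : Fin N → Fin d → R)
    (f : α → Fin d) (h : ↥αᶜ → Fin d) :
    ∏ i, F i (mergeLabels α f h i) = (∏ k : α, F k (f k)) * ∏ k : ↥αᶜ, F k (h k) := by
  rw [← Fintype.prod_subtype_mul_prod_subtype (fun i => i ∈ α)]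
  congr 1
  · exact Fintype.prod_congr _ _ fun k => by simp [mergeLabels]
  · exact Fintype.prod_congr _ _ fun k => by
      simp [mergeLabels, k.2]

theorem mergeLabels_left_inj (α : Set (Fin N)) {f f' : α → Fin d} {h : ↥αᶜ → Fin d} :
    mergeLabels α f h = mergeLabels α f' h ↔ f = f' := by
  refine ⟨fun e => funext fun k => ?_, fun e => e ▸ rfl⟩
  simpa [mergeLabels] using congrFun e k

theorem partialTrace_sum {O : Type*} [Fintype O] (α : Set (Fin N))
    (A : O → Matrix (Fin N → Fin d) (Fin N → Fin d) ℂ) :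
    partialTrace α (∑ a, A a) = ∑ a, partialTrace α (A a) := by
  simp only [partialTrace]
  rw [Finset.sum_comm]
  refine Finset.sum_congr rfl fun h _ => ?_
  ext f f'
  simp [Matrix.sum_apply]

theorem partialTrace_one (α : Set (Fin N)) :
    partialTrace α (1 : Matrix (Fin N → Fin d) (Fin N → Fin d) ℂ) =
      (d : ℂ) ^ Fintype.card ↥αᶜ • 1 := by
  ext f f'
  simp [partialTrace, Matrix.sum_apply, one_apply, mergeLabels_left_inj]

theorem isMeasurementSet_reducedMeasurement (hd : 0 < d) (α : Set (Fin N)) {X O : Type*}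
    [Fintype O] {M : X → O → Matrix (Fin N → Fin d) (Fin N → Fin d) ℂ}
    (hM : IsMeasurementSet M) : IsMeasurementSet (reducedMeasurement α M) := by
  refine ⟨fun x a => ?_, fun x => ?_⟩
  · exact (posSemidef_sum _ fun h _ => (hM.1 x a).submatrix _).smul (by positivity)
  · have : (d : ℂ) ≠ 0 := by exact_mod_cast hd.ne'
    simp only [reducedMeasurement]
    rw [← Finset.smul_sum, ← partialTrace_sum, hM.2, partialTrace_one, smul_smul,
      inv_mul_cancel₀ (pow_ne_zero _ this), one_smul]

theorem partialTrace_rankOne_productVector (α : Set (Fin N))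
    {v : Fin N → Fin d → EuclideanSpace ℂ (Fin d)} {a : Fin N → Fin d}
    (hv : ∀ k, vecNormSq (v k (a k)).ofLp = 1) :
    partialTrace α (rankOne (productVector v a).ofLp) =
      rankOne (productVector (fun k : α => v k) fun k => a k).ofLp := by
  -- The traced out factors contribute the product of their squared norms.
  have hn : ∑ h : ↥αᶜ → Fin d, ∏ k : ↥αᶜ, (v k (a k) (h k) * star (v k (a k) (h k))) = 1 := by
    have := Finset.prod_univ_sum (fun _ : ↥αᶜ => (Finset.univ : Finset (Fin d)))
      fun k j => v k (a k) j * star (v k (a k) j)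
    rw [Fintype.piFinset_univ] at this
    rw [← this]
    refine Finset.prod_eq_one fun k _ => ?_
    have := star_dotProduct_self_eq (v k (a k)).ofLp
    rw [hv, dotProduct_comm] at this
    simpa [dotProduct] using this
  ext f f'
  simp only [partialTrace, Matrix.sum_apply, submatrix_apply, rankOne, vecMulVec_apply,
    productVector, Pi.star_apply, star_prod, ← Finset.prod_mul_distrib]
  rw [← mul_one (∏ k : α, _), ← hn, Finset.mul_sum]
  refine Finset.sum_congr rfl fun h _ => ?_
  rw [Finset.prod_mul_distrib, prod_mergeLabels α fun i j => v i (a i) j,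
    prod_mergeLabels α fun i j => star (v i (a i) j), mul_mul_mul_comm, ← Finset.prod_mul_distrib,
    ← Finset.prod_mul_distrib]

end Reduction

/-! ### Monotonicity of the performance functions -/

section Performance

variable {N : ℕ} (H : Hypergraph (Fin N))

theorem monotone_performance {φ : H.edgeSet → ℝ≥0 → EReal} (hφ : ∀ α, Monotone (φ α)) :
    Monotone (performance H φ) :=
  fun _ _ h => Finset.sum_le_sum fun α _ => hφ α (h α)

theorem monotone_fairness : Monotone (fairness H) :=
  monotone_performance H fun _ _ _ h => ENNReal.log_monotone (ENNReal.coe_le_coe.2 h)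

theorem workProb_nonneg {p : Fin N → ℝ} (hp : ∀ i, p i ∈ Set.Icc (0 : ℝ) 1) (α : Set (Fin N)) :
    0 ≤ workProb p α :=
  mul_nonneg (Finset.prod_nonneg fun i _ => (hp i).1)
    (Finset.prod_nonneg fun i _ => sub_nonneg.2 (hp i).2)

theorem monotone_reliability {p : Fin N → ℝ} (hp : ∀ i, p i ∈ Set.Icc (0 : ℝ) 1) :
    Monotone (reliability H p) :=
  monotone_performance H fun α _ _ h => EReal.coe_le_coe_iff.2
    (mul_le_mul_of_nonneg_left (NNReal.coe_le_coe.2 h) (workProb_nonneg hp α))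

end Performance

end

noncomputable section

/-! ### Optimality of product unbiased bases -/

section ProductUnbiased

variable {N d : ℕ} {u : Fin 2 → Fin N → Fin d → EuclideanSpace ℂ (Fin d)}

theorem reducedMeasurement_productVector (hu : ∀ k, IsUnbiasedPair fun x => u x k)
    (α : Set (Fin N)) (x : Fin 2) (a : Fin N → Fin d) :
    reducedMeasurement α (rankOneMeasurement fun x => productVector (u x)) x a =
      ((d : ℂ) ^ Fintype.card ↥αᶜ)⁻¹ •
        rankOneMeasurement (fun x => productVector fun k : α => u x k) x (fun k => a k) :=
  congrArg (((d : ℂ) ^ Fintype.card ↥αᶜ)⁻¹ • ·) (partialTrace_rankOne_productVector α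
    fun k => (hu k).vecNormSq_eq_one x (a k))

theorem genRobustness_reducedMeasurement_productVector (hd : 0 < d)
    (hu : ∀ k, IsUnbiasedPair fun x => u x k) (α : Set (Fin N)) :
    genRobustness (reducedMeasurement α (rankOneMeasurement fun x => productVector (u x))) =
      unbiasedRobustness (Fintype.card (α → Fin d)) := by
  have : Nonempty (α → Fin d) := ⟨fun _ => ⟨0, hd⟩⟩
  have hα : IsUnbiasedPair fun x => productVector fun k : α => u x k :=
    isUnbiasedPair_productVector fun k => hu k
  refine hα.genRobustness_eq (f := fun a k => a k)
    (c := ((d : ℝ) ^ Fintype.card ↥αᶜ)⁻¹) (isMeasurementSet_reducedMeasurement hd α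
      (isUnbiasedPair_productVector hu).isMeasurementSet) (fun x a => ?_) ?_
  · rw [reducedMeasurement_productVector hu, ← Complex.coe_smul]
    push_cast
    rfl
  -- Weight times number of outcomes: `d ^ N / d ^ |αᶜ| = d ^ |α|`, the dimension of the reduced
  -- space.
  · have hcard : Fintype.card α + Fintype.card ↥αᶜ = N := by
      rw [← Fintype.card_sum, Fintype.card_congr (Equiv.Set.sumCompl α), Fintype.card_fin]
    have hd' : (d : ℝ) ≠ 0 := by exact_mod_cast hd.ne'
    simp only [Fintype.card_fun, Fintype.card_fin, Nat.cast_pow]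
    rw [inv_mul_eq_iff_eq_mul₀ (pow_ne_zero _ hd'), ← pow_add, add_comm, hcard]

theorem genRobustness_le_reducedMeasurement_productVector (hd : 0 < d)
    (hu : ∀ k, IsUnbiasedPair fun x => u x k) (α : Set (Fin N)) {O : Type*} [Fintype O]
    {P : Fin 2 → O → Matrix (α → Fin d) (α → Fin d) ℂ} (hP : IsMeasurementSet P) :
    genRobustness P ≤
      genRobustness (reducedMeasurement α (rankOneMeasurement fun x => productVector (u x))) := by
  have : Nonempty (α → Fin d) := ⟨fun _ => ⟨0, hd⟩⟩
  rw [genRobustness_reducedMeasurement_productVector hd hu]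
  exact genRobustness_le_unbiasedRobustness hP

theorem allocation_le_allocation_productVector (hd : 0 < d)
    (hu : ∀ k, IsUnbiasedPair fun x => u x k) (H : Hypergraph (Fin N)) {O : Type*} [Fintype O]
    {P : Fin 2 → O → Matrix (Fin N → Fin d) (Fin N → Fin d) ℂ} (hP : IsMeasurementSet P) :
    allocation H P ≤ allocation H (rankOneMeasurement fun x => productVector (u x)) := by
  intro α
  have h := isMeasurementSet_reducedMeasurement hd α.1 hP
  exact genRobustness_le_reducedMeasurement_productVector hd hu α.1 h

theorem isOptimalSolution_productVector (hd : 0 < d)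
    (hu : ∀ k, IsUnbiasedPair fun x => u x k) (H : Hypergraph (Fin N))
    {Φ : (H.edgeSet → ℝ≥0) → EReal} (hΦ : Monotone Φ) :
    IsOptimalSolution H Φ (rankOneMeasurement fun x => productVector (u x)) :=
  ⟨(isUnbiasedPair_productVector hu).isMeasurementSet, fun _ _ hP =>
    hΦ (allocation_le_allocation_productVector hd hu H hP)⟩

end ProductUnbiased

end

theorem theorem1 (N d : ℕ) (hd : 0 < d) :
    -- pairs of product unbiased bases exist
    (∃ u : Fin 2 → Fin N → Fin d → EuclideanSpace ℂ (Fin d),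
      ∀ k, IsUnbiasedPair fun x => u x k) ∧
    -- reductions of measurements are measurements
    (∀ (α : Set (Fin N)) (o : ℕ) (P : Fin 2 → Fin o → Matrix (Fin N → Fin d) (Fin N → Fin d) ℂ),
      IsMeasurementSet P → IsMeasurementSet (reducedMeasurement α P)) ∧
    ∀ u : Fin 2 → Fin N → Fin d → EuclideanSpace ℂ (Fin d),
      (∀ k, IsUnbiasedPair fun x => u x k) →
      -- the product bases are mutually unbiased and their projectors form a pair of POVMs
      IsUnbiasedPair (fun x => productVector (u x)) ∧
      IsMeasurementSet (rankOneMeasurement fun x => productVector (u x)) ∧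
      -- every reduction is again given by a pair of product unbiased bases and is maximal
      (∀ α : Set (Fin N),
        IsUnbiasedPair (fun x => productVector fun k : α => u x k) ∧
        (∀ (x : Fin 2) (a : Fin N → Fin d),
          reducedMeasurement α (rankOneMeasurement fun x => productVector (u x)) x a =
            ((d : ℂ) ^ Fintype.card ↥αᶜ)⁻¹ •
              rankOneMeasurement (fun x => productVector fun k : α => u x k) x (fun k => a k)) ∧
        genRobustness (reducedMeasurement α (rankOneMeasurement fun x => productVector (u x))) =
          genRobustness (rankOneMeasurement fun x => productVector fun k : α => u x k) ∧
        genRobustness (reducedMeasurement α (rankOneMeasurement fun x => productVector (u x))) ∈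
          robustnessSet (reducedMeasurement α (rankOneMeasurement fun x => productVector (u x))) ∧
        ∀ (o : ℕ) (P : Fin 2 → Fin o → Matrix (α → Fin d) (α → Fin d) ℂ),
          IsMeasurementSet P →
          (robustnessSet P).Nonempty ∧
          genRobustness P ≤
            genRobustness
              (reducedMeasurement α (rankOneMeasurement fun x => productVector (u x)))) ∧
      -- optimality for every hypergraph and every monotone performance function
      ∀ H : Hypergraph (Fin N),
        (∀ Φ : (H.edgeSet → ℝ≥0) → EReal, Monotone Φ →
          IsOptimalSolution H Φ (rankOneMeasurement fun x => productVector (u x))) ∧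
        (∀ φ : H.edgeSet → ℝ≥0 → EReal, (∀ α, Monotone (φ α)) →
          IsOptimalSolution H (performance H φ)
            (rankOneMeasurement fun x => productVector (u x))) ∧
        IsOptimalSolution H (fairness H) (rankOneMeasurement fun x => productVector (u x)) ∧
        ∀ p : Fin N → ℝ, (∀ i, p i ∈ Set.Icc (0 : ℝ) 1) →
          IsOptimalSolution H (reliability H p)
            (rankOneMeasurement fun x => productVector (u x)) := by
  refine ⟨?_, fun α o P hP => isMeasurementSet_reducedMeasurement hd α hP, fun u hu => ?_⟩
  · obtain ⟨w, hw⟩ := exists_isUnbiasedPair hd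
    exact ⟨fun x _ => w x, fun _ => hw⟩
  have hprod : IsUnbiasedPair (fun x => productVector (u x)) := isUnbiasedPair_productVector hu
  refine ⟨hprod, hprod.isMeasurementSet, fun α => ?_, fun H =>
    ⟨fun _ hΦ => isOptimalSolution_productVector hd hu H hΦ,
      fun _ hφ => isOptimalSolution_productVector hd hu H (monotone_performance H hφ),
      isOptimalSolution_productVector hd hu H (monotone_fairness H),
      fun _ hp => isOptimalSolution_productVector hd hu H (monotone_reliability H hp)⟩⟩
  have hne : Nonempty (α → Fin d) := ⟨fun _ => ⟨0, hd⟩⟩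
  have hα : IsUnbiasedPair (fun x => productVector fun k : α => u x k) :=
    isUnbiasedPair_productVector fun k => hu k
  refine ⟨hα, reducedMeasurement_productVector hu α, ?_, ?_, fun o P hP =>
    ⟨⟨_, unbiasedRobustness_mem_robustnessSet hP⟩,
      genRobustness_le_reducedMeasurement_productVector hd hu α hP⟩⟩
  · rw [genRobustness_reducedMeasurement_productVector hd hu]
    exact (hα.genRobustness_eq (f := id) (c := 1) hα.isMeasurementSet
      (fun x a => (one_smul _ _).symm) (one_mul _)).symm
  -- The infimum is attained because its value is the universal noise level, which is itself
  -- feasible.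
  · rw [genRobustness_reducedMeasurement_productVector hd hu]
    exact unbiasedRobustness_mem_robustnessSet
      (isMeasurementSet_reducedMeasurement hd α hprod.isMeasurementSet)
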